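/- Let $N\ge 0$ be an integer and let $\lambda,\mu$ and $M_j,\bar M_j,c_j,\bar c_j$ $(j=1,\dots,N)$ be arbitrary real constants (in all $4N+2$ of them; the bar does not denote complex conjugation), subject only to the conditions under which the formulas below make sense: $\lambda\neq\pm\mu$, $M_j\neq\bar M_k$ for all $j,k$, and $M_j,\bar M_j\notin\{\lambda,-\lambda,\mu,-\mu\}$ for all $j$. Put $\mathsf M=\mathrm{diag}(M_1,\dots,M_N)$, $\bar{\mathsf M}=\mathrm{diag}(\bar M_1,\dots,\bar M_N)$ and, for $\zeta\in\{\lambda,\mu\}$, $$\mathsf H_\zeta=(\mathsf M-\zeta)(\mathsf M+\zeta)^{-1},\quad \bar{\mathsf H}_\zeta=(\bar{\mathsf M}+\zeta)(\bar{\mathsf M}-\zeta)^{-1},\quad \mathsf L_\zeta=\mathsf H_\zeta-\mathsf H_\zeta^{-1},\quad \bar{\mathsf L}_\zeta=\bar{\mathsf H}_\zeta-\bar{\mathsf H}_\zeta^{-1}.$$ For $x,y\in\mathbb R$ and $n_1,n_2\in\mathbb Z$ let $$\mathsf A=\mathsf A_0\exp(x\mathsf L_\lambda+y\mathsf L_\mu)\,\mathsf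 H_\lambda^{n_1+n_2}\mathsf H_\mu^{n_2-n_1},\qquad (\mathsf A_0)_{j,k}=\frac{c_k}{\bar M_j-M_k},$$ $$\bar{\mathsf A}=\bar{\mathsf A}_0\exp(x\bar{\mathsf L}_\lambda+y\bar{\mathsf L}_\mu)\,\bar{\mathsf H}_\lambda^{n_1+n_2}\bar{\mathsf H}_\mu^{n_2-n_1},\qquad (\bar{\mathsf A}_0)_{j,k}=\frac{\bar c_k}{M_j-\bar M_k},$$ $$\tau(x,y,n_1,n_2)=\det(\mathsf 1+\mathsf A\bar{\mathsf A}),\qquad \varphi(x,y,n_1,n_2)=8xy\,\frac{\lambda\mu(\lambda^2+\mu^2)}{(\lambda^2-\mu^2)^2}+(n_1^2-n_2^2)\ln\left|\frac{\lambda+\mu}{\lambda-\mu}\right|.$$ Then $u=\varphi+\ln\tau$ solves the $(2+2)$-dimensional Toda lattice $$\frac{\partial^2u}{\partial x\,\partial y}=e^{\Delta_1u}-e^{\Delta_2u},$$ where $\Delta_1u(n_1,n_2)=u(n_1+1,n_2)-2u(n_1,n_2)+u(n_1-1,n_2)$ and $\Delta_2u(n_1,n_2)=u(n_1,n_2+1)-2u(n_1,n_2)+u(n_1,n_2-1)$,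 wherever $u$ is defined. Precisely: at every point $(x,y,n_1,n_2)$ such that $\tau(x,y,\cdot,\cdot)>0$ at the five sites $(n_1,n_2)$, $(n_1\pm1,n_2)$, $(n_1,n_2\pm1)$, the real function $u(\cdot,\cdot,n_1,n_2)$ is $C^\infty$ near $(x,y)$ and the equation holds. If $\tau$ is only assumed to be nonzero at these five sites, the same is true of the complex-valued function $u=\varphi+\ln\tau$, where $\ln$ is the principal logarithm ($\ln\tau=\ln|\tau|+i\pi$ for $\tau<0$). -/

import Mathlib

open scoped ContDiff

noncomputable section

namespace Toda22

/-- The second-order difference in the first discrete variable. -/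
def lap₁ {R : Type*} [Ring R] (f : ℤ → ℤ → R) (n₁ n₂ : ℤ) : R :=
  f (n₁ + 1) n₂ - 2 * f n₁ n₂ + f (n₁ - 1) n₂

/-- The second-order difference in the second discrete variable. -/
def lap₂ {R : Type*} [Ring R] (f : ℤ → ℤ → R) (n₁ n₂ : ℤ) : R :=
  f n₁ (n₂ + 1) - 2 * f n₁ n₂ + f n₁ (n₂ - 1)

/-- The real-valued function `u(x, y, n₁, n₂)` is smooth in `(x, y)` near the given point
and satisfies `u_xy = e^{Δ₁ u} - e^{Δ₂ u}` there. -/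
def SolvesAt (u : ℝ → ℝ → ℤ → ℤ → ℝ) (x y : ℝ) (n₁ n₂ : ℤ) : Prop :=
  ContDiffAt ℝ ∞ (fun p : ℝ × ℝ => u p.1 p.2 n₁ n₂) (x, y) ∧
    deriv (fun s => deriv (fun t => u s t n₁ n₂) y) x
      = Real.exp (lap₁ (u x y) n₁ n₂) - Real.exp (lap₂ (u x y) n₁ n₂)

/-- The same for a complex-valued function of real `x`, `y` and integer `n₁`, `n₂`. -/
def ComplexSolvesAt (u : ℝ → ℝ → ℤ → ℤ → ℂ) (x y : ℝ) (n₁ n₂ : ℤ) : Prop :=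
  ContDiffAt ℝ ∞ (fun p : ℝ × ℝ => u p.1 p.2 n₁ n₂) (x, y) ∧
    deriv (fun s => deriv (fun t => u s t n₁ n₂) y) x
      = Complex.exp (lap₁ (u x y) n₁ n₂) - Complex.exp (lap₂ (u x y) n₁ n₂)

variable {N : ℕ}

/-- `H_ζ = (M - ζ) (M + ζ)⁻¹` for the diagonal matrix `M`. -/
def H (M : Fin N → ℝ) (ζ : ℝ) : Matrix (Fin N) (Fin N) ℝ :=
  (Matrix.diagonal M - ζ • (1 : Matrix (Fin N) (Fin N) ℝ))
    * (Matrix.diagonal M + ζ • (1 : Matrix (Fin N) (Fin N) ℝ))⁻¹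

/-- `H̄_ζ = (M̄ + ζ) (M̄ - ζ)⁻¹` for the diagonal matrix `M̄`. -/
def Hbar (M' : Fin N → ℝ) (ζ : ℝ) : Matrix (Fin N) (Fin N) ℝ :=
  (Matrix.diagonal M' + ζ • (1 : Matrix (Fin N) (Fin N) ℝ))
    * (Matrix.diagonal M' - ζ • (1 : Matrix (Fin N) (Fin N) ℝ))⁻¹

/-- `L_ζ = H_ζ - H_ζ⁻¹`. -/
def L (M : Fin N → ℝ) (ζ : ℝ) : Matrix (Fin N) (Fin N) ℝ :=
  H M ζ - (H M ζ)⁻¹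

/-- `L̄_ζ = H̄_ζ - H̄_ζ⁻¹`. -/
def Lbar (M' : Fin N → ℝ) (ζ : ℝ) : Matrix (Fin N) (Fin N) ℝ :=
  Hbar M' ζ - (Hbar M' ζ)⁻¹

/-- The constant Cauchy-type matrix with entries `c_k / (P_j - Q_k)`. -/
def cauchyMatrix (P Q c : Fin N → ℝ) : Matrix (Fin N) (Fin N) ℝ :=
  Matrix.of fun j k => c k / (P j - Q k)

/-- The matrix `A(x, y, n₁, n₂)`. -/
def A (l m : ℝ) (M M' c : Fin N → ℝ) (x y : ℝ) (n₁ n₂ : ℤ) : Matrix (Fin N) (Fin N) ℝ :=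
  cauchyMatrix M' M c * NormedSpace.exp (x • L M l + y • L M m)
    * H M l ^ (n₁ + n₂) * H M m ^ (n₂ - n₁)

/-- The matrix `Ā(x, y, n₁, n₂)`. -/
def Abar (l m : ℝ) (M M' c' : Fin N → ℝ) (x y : ℝ) (n₁ n₂ : ℤ) : Matrix (Fin N) (Fin N) ℝ :=
  cauchyMatrix M M' c' * NormedSpace.exp (x • Lbar M' l + y • Lbar M' m)
    * Hbar M' l ^ (n₁ + n₂) * Hbar M' m ^ (n₂ - n₁)

/-- The tau-function `τ = det (1 + A Ā)`. -/
def tau (l m : ℝ) (M M' c c' : Fin N → ℝ) (x y : ℝ) (n₁ n₂ : ℤ) : ℝ :=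
  (1 + A l m M M' c x y n₁ n₂ * Abar l m M M' c' x y n₁ n₂).det

/-- The background `φ`. -/
def phi (l m : ℝ) (x y : ℝ) (n₁ n₂ : ℤ) : ℝ :=
  8 * x * y * (l * m * (l ^ 2 + m ^ 2) / (l ^ 2 - m ^ 2) ^ 2)
    + ((n₁ : ℝ) ^ 2 - (n₂ : ℝ) ^ 2) * Real.log |(l + m) / (l - m)|

/-- The function `u = φ + ln τ`, meant where `τ > 0`. -/
def soliton (l m : ℝ) (M M' c c' : Fin N → ℝ) (x y : ℝ) (n₁ n₂ : ℤ) : ℝ :=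
  phi l m x y n₁ n₂ + Real.log (tau l m M M' c c' x y n₁ n₂)

/-- The function `u = φ + ln τ` with the principal complex logarithm, meant where `τ ≠ 0`. -/
def complexSoliton (l m : ℝ) (M M' c c' : Fin N → ℝ) (x y : ℝ) (n₁ n₂ : ℤ) : ℂ :=
  (phi l m x y n₁ n₂ : ℂ) + Complex.log (tau l m M M' c c' x y n₁ n₂ : ℂ)

/-- The property `P` holds at the site `(n₁, n₂)` and at its four nearest neighbours, that is,
at all the sites that enter the equation at `(n₁, n₂)`. -/
def OnStencil (P : ℤ → ℤ → Prop) (n₁ n₂ : ℤ) : Prop :=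
  P n₁ n₂ ∧ P (n₁ + 1) n₂ ∧ P (n₁ - 1) n₂ ∧ P n₁ (n₂ + 1) ∧ P n₁ (n₂ - 1)

end Toda22

end

/-!
Write `P = M̄`, `Q = M`; the parameters `λ`, `μ` are `l`, `m` in the code. Both `A` and `Ā` are
Cauchy matrices `a_k / (P_j - Q_k)`,
`b_k / (Q_j - P_k)` whose weights `a`, `b` carry all the dependence on `x`, `y`, `n₁`, `n₂`, and they
satisfy Sylvester equations with right-hand sides of rank one. Hence the change of the determinant
`τ = det (1 + A Ā)` under the discrete shifts and the flows in `x` and `y` is expressed by the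
scalars `green t s = ∑ a_j / (Q_j - t) * X_jk / (P_k - s)`, where `X = Ā (1 + A Ā)⁻¹` and
`t`, `s` run through the four points `±λ`, `±μ`, or by `f t s = 1 + (t - s) green t s`:

* each of the four neighbouring sites is reached by multiplying the weights by a function with two
  of these points as zeros and the other two as poles, and the ratio of the values of `τ` is a
  `2 × 2` determinant of Cauchy type in `f` (`cauchyTau_shift`);
* `∂_y ln τ = -2μ (green μ μ + green (-μ) (-μ))`, because `exp (y L_μ)` has the logarithmic velocity
  `L_μ = -2μ (1 / (M - μ) + 1 / (M + μ))` (`FlowsAt.hasDerivAt_cauchyTau`), and differentiation in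
  `x` turns this into a combination of the products `f t s * f s t` with `t = ±λ`, `s = ±μ`
  (`FlowsAt.hasDerivAt_green`).

The equation for `u` thus becomes a polynomial identity among the numbers `f t s`. It is not true
for arbitrary `f`, but the commutator of `X` with the nodes has rank at most two, so that `f t s` is the
scalar product of a plane vector depending on `t` with one depending on `s` (`twoPoint_factor`), and
`f t t = 1`; for such `f` the identity holds (`twoPoint_bilinear`).

For `τ` of arbitrary sign the principal logarithm of `τ` is, locally, `ln |τ|` plus a constant, and
the exponentials of the second differences are ratios of values of `τ` in both the real and the
complex case.
-/

noncomputable section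

namespace Toda22

open Matrix
open scoped ContDiff Matrix

variable {N : ℕ}

/-! ### Cauchy matrices and the two-point function -/

/-- The determinant `det (1 + A B)` for the Cauchy matrices `A`, `B` with nodes `P`, `Q` and
arbitrary weights `a`, `b`. The tau-function is its value at weights depending on the site and
on `(x, y)`. -/
def cauchyTau (P Q a b : Fin N → ℝ) : ℝ :=
  (1 + cauchyMatrix P Q a * cauchyMatrix Q P b).det

/-- The matrix `X = B (1 + A B)⁻¹`, meant where `cauchyTau P Q a b ≠ 0`. -/
def resolvent (P Q a b : Fin N → ℝ) : Matrix (Fin N) (Fin N) ℝ :=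
  cauchyMatrix Q P b * (1 + cauchyMatrix P Q a * cauchyMatrix Q P b)⁻¹

/-- The vector with entries `1 / (P_k - s)`, meant for `s` distinct from all the `P_k`. -/
def invSub (P : Fin N → ℝ) (s : ℝ) : Fin N → ℝ := fun k => (P k - s)⁻¹

/-- The resolvent `X` sandwiched between the row `a_j / (Q_j - t)` and the column
`1 / (P_k - s)`. -/
def green (P Q a b : Fin N → ℝ) (t s : ℝ) : ℝ :=
  (a * invSub Q t) ⬝ᵥ (resolvent P Q a b *ᵥ invSub P s)

/-- The function `f t s = 1 + (t - s) * green t s`. By the matrix determinant lemma, it is the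
factor by which the determinant changes under `a ↦ a (Q - s) / (Q - t)`,
`b ↦ b (P - t) / (P - s)`. -/
def twoPoint (P Q a b : Fin N → ℝ) (t s : ℝ) : ℝ :=
  1 + (t - s) * green P Q a b t s

/-- A Cauchy matrix solves a Sylvester equation with right-hand side of rank one. -/
theorem diagonal_mul_cauchyMatrix {P Q : Fin N → ℝ} (h : ∀ j k, P j ≠ Q k) (a : Fin N → ℝ) :
    diagonal P * cauchyMatrix P Q a = cauchyMatrix P Q a * diagonal Q + vecMulVec 1 a := by
  ext j k
  have := sub_ne_zero.2 (h j k)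
  simp only [cauchyMatrix, diagonal_mul, mul_diagonal, Matrix.add_apply, vecMulVec_apply, of_apply,
    Pi.one_apply]
  field_simp
  ring

theorem cauchyMatrix_mul_diagonal_invSub {P Q : Fin N → ℝ} (h : ∀ j k, P j ≠ Q k)
    (a : Fin N → ℝ) {t : ℝ} (hP : ∀ k, P k ≠ t) (hQ : ∀ k, Q k ≠ t) :
    cauchyMatrix P Q a * diagonal (invSub Q t) =
      diagonal (invSub P t) * cauchyMatrix P Q a + vecMulVec (invSub P t) (a * invSub Q t) := by
  ext j k
  have h1 := sub_ne_zero.2 (h j k)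
  have h2 := sub_ne_zero.2 (hP j)
  have h3 := sub_ne_zero.2 (hQ k)
  simp only [cauchyMatrix, invSub, diagonal_mul, mul_diagonal, Matrix.add_apply, vecMulVec_apply,
    of_apply, Pi.mul_apply]
  field_simp
  ring

theorem resolvent_mul {P Q a b : Fin N → ℝ} (h0 : cauchyTau P Q a b ≠ 0) :
    resolvent P Q a b * (1 + cauchyMatrix P Q a * cauchyMatrix Q P b) = cauchyMatrix Q P b := by
  have hu : IsUnit (1 + cauchyMatrix P Q a * cauchyMatrix Q P b).det := isUnit_iff_ne_zero.2 h0
  rw [resolvent, Matrix.mul_assoc, nonsing_inv_mul _ hu, Matrix.mul_one]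

/-- The commutator of the resolvent with the diagonal matrices of nodes has rank at most two. -/
theorem diagonal_mul_resolvent {P Q : Fin N → ℝ} (h : ∀ j k, P j ≠ Q k) {a b : Fin N → ℝ}
    (h0 : cauchyTau P Q a b ≠ 0) :
    diagonal Q * resolvent P Q a b = resolvent P Q a b * diagonal P
      + vecMulVec ((1 - resolvent P Q a b * cauchyMatrix P Q a) *ᵥ 1)
          (b ᵥ* (1 + cauchyMatrix P Q a * cauchyMatrix Q P b)⁻¹)
      - vecMulVec (resolvent P Q a b *ᵥ 1) (a ᵥ* resolvent P Q a b) := by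
  have hu : IsUnit (1 + cauchyMatrix P Q a * cauchyMatrix Q P b).det := isUnit_iff_ne_zero.2 h0
  have hA := diagonal_mul_cauchyMatrix h a
  have hB := diagonal_mul_cauchyMatrix (fun j k => (h k j).symm) b
  have hX := resolvent_mul h0
  simp only [← mul_vecMulVec, ← vecMulVec_mul]
  set A := cauchyMatrix P Q a
  set B := cauchyMatrix Q P b
  set X := resolvent P Q a b
  have hXd : X = B * (1 + A * B)⁻¹ := rfl
  set S := (1 + A * B)⁻¹
  have hS : (1 + A * B) * S = 1 := mul_nonsing_inv _ hu
  set p := diagonal P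
  set q := diagonal Q
  set ea : Matrix (Fin N) (Fin N) ℝ := vecMulVec 1 a
  set eb : Matrix (Fin N) (Fin N) ℝ := vecMulVec 1 b
  -- it suffices to compare after multiplication by the invertible matrix `1 + A * B`
  have key : q * X * (1 + A * B) =
      (X * p + (1 - X * A) * (eb * S) - X * (ea * X)) * (1 + A * B) := by
    have e1 : S * (1 + A * B) = 1 := nonsing_inv_mul _ hu
    calc q * X * (1 + A * B) = q * B := by rw [Matrix.mul_assoc, hX]
      _ = X * (1 + A * B) * p + eb := by rw [hB, hX]
      _ = X * (p * (1 + A * B)) - X * ea * B - X * A * eb + eb := by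
        have : (1 + A * B) * p = p * (1 + A * B) - ea * B - A * eb := by
          have e2 : A * B * p = p * (A * B) - ea * B - A * eb := by
            rw [Matrix.mul_assoc, ← sub_eq_iff_eq_add.2 hB, ← Matrix.mul_assoc p, hA]
            noncomm_ring
          rw [Matrix.add_mul, e2]; noncomm_ring
        rw [Matrix.mul_assoc, this]; noncomm_ring
      _ = X * (p * (1 + A * B)) - X * ea * (X * (1 + A * B))
            + (1 - X * A) * eb * (S * (1 + A * B)) := by rw [hX, e1]; noncomm_ring
      _ = _ := by noncomm_ring
  have := congrArg (· * S) key
  simpa only [Matrix.mul_assoc, hS, Matrix.mul_one] using this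

/-- The two-point function is a scalar product of vectors of the plane, one depending on `t` and
one on `s`: this is the rank-two commutator relation of `diagonal_mul_resolvent`, paired with the
row and the column that define `green`. -/
theorem twoPoint_factor {P Q : Fin N → ℝ} (h : ∀ j k, P j ≠ Q k) {a b : Fin N → ℝ}
    (h0 : cauchyTau P Q a b ≠ 0) :
    ∃ α₁ α₂ β₁ β₂ : ℝ → ℝ, ∀ t s, (∀ k, Q k ≠ t) → (∀ k, P k ≠ s) →
      twoPoint P Q a b t s = α₁ t * β₁ s + α₂ t * β₂ s := by
  have hq := diagonal_mul_resolvent h h0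
  refine ⟨fun t => 1 + (a * invSub Q t) ⬝ᵥ (resolvent P Q a b *ᵥ 1),
    fun t => (a * invSub Q t) ⬝ᵥ ((1 - resolvent P Q a b * cauchyMatrix P Q a) *ᵥ 1),
    fun s => 1 - (a ᵥ* resolvent P Q a b) ⬝ᵥ invSub P s,
    fun s => (b ᵥ* (1 + cauchyMatrix P Q a * cauchyMatrix Q P b)⁻¹) ⬝ᵥ invSub P s,
    fun t s ht hs => ?_⟩
  have h1 := congrArg (fun Z => (a * invSub Q t) ⬝ᵥ (Z *ᵥ invSub P s)) hq
  have e1 : (a * invSub Q t) ᵥ* diagonal Q = a + t • (a * invSub Q t) := by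
    ext k
    have := sub_ne_zero.2 (ht k)
    simp [invSub, vecMul_diagonal]; field_simp; ring
  have e2 : diagonal P *ᵥ invSub P s = 1 + s • invSub P s := by
    ext k
    have := sub_ne_zero.2 (hs k)
    simp [invSub, mulVec_diagonal]; field_simp; ring
  simp only [add_mulVec, sub_mulVec, ← mulVec_mulVec, vecMulVec_mulVec, dotProduct_add,
    dotProduct_sub] at h1
  rw [dotProduct_mulVec _ (diagonal Q), e1, e2] at h1
  simp only [mulVec_add, mulVec_smul, add_dotProduct, dotProduct_add, smul_dotProduct,
    dotProduct_smul, smul_eq_mul, MulOpposite.smul_eq_mul_unop, MulOpposite.unop_op] at h1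
  rw [twoPoint, green]
  simp only [← dotProduct_mulVec] at h1 ⊢
  simp only [sub_mulVec, dotProduct_sub, ← mulVec_mulVec] at h1 ⊢
  linear_combination h1

/-! ### Multiplying the weights by a rational function -/

theorem cauchyMatrix_mul_weight (P Q a g : Fin N → ℝ) :
    cauchyMatrix P Q (a * g) = cauchyMatrix P Q a * diagonal g := by
  ext j k
  simp only [cauchyMatrix, mul_diagonal, of_apply, Pi.mul_apply]
  ring

/-- Multiplication of the weights `a` by a function `g` with zeros `z₁`, `z₂` and poles `w₁`,
`w₂`, evaluated at `Q`, and of the weights `b` by `1 / g`, evaluated at `P`, changes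
`diag (g P) (1 + A B)`, up to the right factor `diag (1 / g P)`, by a matrix of rank at most two, so the ratio of determinants is a `2 × 2`
determinant of values of `green`, that is, a Cauchy-type determinant of two-point functions. -/
theorem cauchyTau_shift {P Q : Fin N → ℝ} (h : ∀ j k, P j ≠ Q k) {a b : Fin N → ℝ}
    (h0 : cauchyTau P Q a b ≠ 0) {z₁ z₂ w₁ w₂ : ℝ} (hz : z₁ ≠ z₂) (hw : w₁ ≠ w₂)
    (hPz₁ : ∀ k, P k ≠ z₁) (hPz₂ : ∀ k, P k ≠ z₂) (hPw₁ : ∀ k, P k ≠ w₁) (hPw₂ : ∀ k, P k ≠ w₂)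
    (hQw₁ : ∀ k, Q k ≠ w₁) (hQw₂ : ∀ k, Q k ≠ w₂) :
    cauchyTau P Q (a * fun k => (Q k - z₁) * (Q k - z₂) / ((Q k - w₁) * (Q k - w₂)))
        (b * fun k => (P k - w₁) * (P k - w₂) / ((P k - z₁) * (P k - z₂)))
        * ((w₁ - w₂) * (z₂ - z₁)) =
      cauchyTau P Q a b *
        (twoPoint P Q a b w₁ z₁ * twoPoint P Q a b w₂ z₂ * ((w₁ - z₂) * (w₂ - z₁))
          - twoPoint P Q a b w₁ z₂ * twoPoint P Q a b w₂ z₁ * ((w₁ - z₁) * (w₂ - z₂))) := by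
  have hX := resolvent_mul h0
  have hz' : z₁ - z₂ ≠ 0 := sub_ne_zero.2 hz
  have hz'' : z₂ - z₁ ≠ 0 := sub_ne_zero.2 hz.symm
  have hw' : w₁ - w₂ ≠ 0 := sub_ne_zero.2 hw
  have hw'' : w₂ - w₁ ≠ 0 := sub_ne_zero.2 hw.symm
  -- the residues of `g (z) = (z - z₁) (z - z₂) / ((z - w₁) (z - w₂))` at `w₁` and `w₂`
  set ρ₁ := (w₁ - z₁) * (w₁ - z₂) / (w₁ - w₂) with hρ₁
  set ρ₂ := (w₂ - z₁) * (w₂ - z₂) / (w₂ - w₁) with hρ₂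
  set g : (Fin N → ℝ) → Fin N → ℝ :=
    fun R k => (R k - z₁) * (R k - z₂) / ((R k - w₁) * (R k - w₂)) with hg
  set gi : Fin N → ℝ := fun k => (P k - w₁) * (P k - w₂) / ((P k - z₁) * (P k - z₂)) with hgi
  have hgR : ∀ R : Fin N → ℝ, (∀ k, R k ≠ w₁) → (∀ k, R k ≠ w₂) →
      diagonal (g R) = 1 + ρ₁ • diagonal (invSub R w₁) + ρ₂ • diagonal (invSub R w₂) := by
    intro R h1 h2
    rw [← diagonal_one, ← diagonal_smul, ← diagonal_smul, diagonal_add, diagonal_add]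
    congr 1
    ext k
    have := sub_ne_zero.2 (h1 k)
    have := sub_ne_zero.2 (h2 k)
    simp only [hg, invSub, hρ₁, hρ₂, Pi.smul_apply, smul_eq_mul]
    field_simp
    ring
  have hggi : diagonal (g P) * diagonal gi = 1 := by
    rw [diagonal_mul_diagonal, ← diagonal_one]
    congr 1
    ext k
    have := sub_ne_zero.2 (hPz₁ k)
    have := sub_ne_zero.2 (hPz₂ k)
    have := sub_ne_zero.2 (hPw₁ k)
    have := sub_ne_zero.2 (hPw₂ k)
    simp only [hg, hgi]
    field_simp
  -- the partial fraction expansions of `ρᵢ / (g (z) (z - wᵢ))`, whose only poles are `z₁`, `z₂`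
  set u : Fin 2 → Fin N → ℝ :=
    ![ρ₁ • (((z₁ - w₂) / (z₁ - z₂)) • invSub P z₁ + ((z₂ - w₂) / (z₂ - z₁)) • invSub P z₂),
      ρ₂ • (((z₁ - w₁) / (z₁ - z₂)) • invSub P z₁ + ((z₂ - w₁) / (z₂ - z₁)) • invSub P z₂)]
    with hu
  set v : Fin 2 → Fin N → ℝ := ![(a * invSub Q w₁) ᵥ* resolvent P Q a b,
    (a * invSub Q w₂) ᵥ* resolvent P Q a b] with hv
  have hgu₁ : diagonal (g P) *ᵥ u 0 = ρ₁ • invSub P w₁ := by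
    ext k
    have := sub_ne_zero.2 (hPz₁ k)
    have := sub_ne_zero.2 (hPz₂ k)
    have := sub_ne_zero.2 (hPw₁ k)
    have := sub_ne_zero.2 (hPw₂ k)
    simp only [mulVec_diagonal, hu, invSub, hg, Pi.smul_apply, smul_eq_mul, Pi.add_apply,
      cons_val_zero]
    field_simp
    ring
  have hgu₂ : diagonal (g P) *ᵥ u 1 = ρ₂ • invSub P w₂ := by
    ext k
    have := sub_ne_zero.2 (hPz₁ k)
    have := sub_ne_zero.2 (hPz₂ k)
    have := sub_ne_zero.2 (hPw₁ k)
    have := sub_ne_zero.2 (hPw₂ k)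
    simp only [mulVec_diagonal, hu, invSub, hg, Pi.smul_apply, smul_eq_mul, Pi.add_apply,
      cons_val_one, cons_val_fin_one]
    field_simp
    ring
  have hUV : (of fun k i => u i k : Matrix (Fin N) (Fin 2) ℝ) * (of v : Matrix (Fin 2) (Fin N) ℝ)
      = vecMulVec (u 0) (v 0) + vecMulVec (u 1) (v 1) := by
    ext j k
    simp [mul_apply, Fin.sum_univ_two, vecMulVec_apply]
  have e1 := cauchyMatrix_mul_diagonal_invSub h a hPw₁ hQw₁
  have e2 := cauchyMatrix_mul_diagonal_invSub h a hPw₂ hQw₂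
  have key : 1 + cauchyMatrix P Q (a * g Q) * cauchyMatrix Q P (b * gi) =
      diagonal (g P) * (1 + (of fun k i => u i k : Matrix (Fin N) (Fin 2) ℝ)
        * (of v : Matrix (Fin 2) (Fin N) ℝ))
        * (1 + cauchyMatrix P Q a * cauchyMatrix Q P b) * diagonal gi := by
    rw [hUV, Matrix.mul_add (diagonal (g P)), Matrix.mul_add (diagonal (g P)),
      mul_vecMulVec, mul_vecMulVec, hgu₁, hgu₂]
    simp only [hv, cons_val_zero, cons_val_one, cons_val_fin_one]
    rw [← vecMulVec_mul, ← vecMulVec_mul, smul_vecMulVec, smul_vecMulVec,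
      cauchyMatrix_mul_weight, cauchyMatrix_mul_weight, hgR Q hQw₁ hQw₂]
    have e3 : cauchyMatrix P Q a *
          (1 + ρ₁ • diagonal (invSub Q w₁) + ρ₂ • diagonal (invSub Q w₂)) =
        diagonal (g P) * cauchyMatrix P Q a
          + ρ₁ • vecMulVec (invSub P w₁) (a * invSub Q w₁)
          + ρ₂ • vecMulVec (invSub P w₂) (a * invSub Q w₂) := by
      rw [hgR P hPw₁ hPw₂, Matrix.mul_add, Matrix.mul_add, Matrix.mul_smul, Matrix.mul_smul, e1, e2]
      simp only [Matrix.add_mul, Matrix.smul_mul, smul_add, Matrix.one_mul, Matrix.mul_one]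
      abel
    rw [e3]
    simp only [Matrix.add_mul, Matrix.mul_assoc, Matrix.mul_one, Matrix.smul_mul]
    have hX' : resolvent P Q a b *
          (1 * diagonal gi + cauchyMatrix P Q a * (cauchyMatrix Q P b * diagonal gi))
        = cauchyMatrix Q P b * diagonal gi := by
      rw [← Matrix.mul_assoc (cauchyMatrix P Q a), ← Matrix.add_mul, ← Matrix.mul_assoc, hX]
    rw [hX', Matrix.mul_add, Matrix.one_mul, hggi]
    abel
  have hdet := congrArg det key
  have hgg := congrArg det hggi
  rw [det_mul, det_one] at hgg
  rw [det_mul, det_mul, det_mul, det_one_add_mul_comm (of fun k i => u i k), det_fin_two] at hdet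
  have hVU : ∀ i j, ((of v : Matrix (Fin 2) (Fin N) ℝ) *
      (of fun k i => u i k : Matrix (Fin N) (Fin 2) ℝ)) i j = v i ⬝ᵥ u j := by
    intro i j
    simp [mul_apply, dotProduct]
  have hG : ∀ t s, ((a * invSub Q t) ᵥ* resolvent P Q a b) ⬝ᵥ invSub P s = green P Q a b t s := by
    intro t s
    rw [green, dotProduct_mulVec]
  change (1 + cauchyMatrix P Q (a * g Q) * cauchyMatrix Q P (b * gi)).det * _
    = (1 + cauchyMatrix P Q a * cauchyMatrix Q P b).det * _
  rw [hdet]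
  have hM : ∀ i j, (1 + (of v : Matrix (Fin 2) (Fin N) ℝ) *
      (of fun k i => u i k : Matrix (Fin N) (Fin 2) ℝ) : Matrix (Fin 2) (Fin 2) ℝ) i j
        = (if i = j then 1 else 0) + v i ⬝ᵥ u j := by
    intro i j
    rw [Matrix.add_apply, one_apply, hVU]
  have hpull : ∀ p X T q c : ℝ, p * X * T * q * c = p * q * (T * (X * c)) := by
    intros; ring
  rw [hpull, hgg, one_mul]
  congr 1
  simp only [hM, if_true, if_neg (zero_ne_one : (0 : Fin 2) ≠ 1),
    if_neg (one_ne_zero : (1 : Fin 2) ≠ 0), zero_add]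
  simp only [hu, hv, cons_val_zero, cons_val_one, cons_val_fin_one, dotProduct_smul,
    dotProduct_add, smul_eq_mul, hG, twoPoint]
  generalize green P Q a b w₁ z₁ = g11
  generalize green P Q a b w₁ z₂ = g12
  generalize green P Q a b w₂ z₁ = g21
  generalize green P Q a b w₂ z₂ = g22
  rw [hρ₁, hρ₂]
  field_simp
  ring

/-! ### Derivatives of determinants and inverses -/

/-- Jacobi's formula. -/
theorem hasDerivAt_det {n : Type*} [Fintype n] [DecidableEq n] {B : ℝ → Matrix n n ℝ}
    {B' : Matrix n n ℝ} {x : ℝ} (h : ∀ i j, HasDerivAt (fun t => B t i j) (B' i j) x) :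
    HasDerivAt (fun t => (B t).det) (trace (adjugate (B x) * B')) x := by
  have h1 : HasDerivAt (fun t => ∑ σ : Equiv.Perm n, (Equiv.Perm.sign σ : ℝ) * ∏ i, B t (σ i) i)
      (∑ σ : Equiv.Perm n, (Equiv.Perm.sign σ : ℝ) *
        ∑ i, (∏ j ∈ Finset.univ.erase i, B x (σ j) j) • B' (σ i) i) x :=
    HasDerivAt.fun_sum fun σ _ =>
      (HasDerivAt.fun_finsetProd fun i _ => h (σ i) i).const_mul _
  simp only [det_apply']
  convert h1 using 1
  have h2 : ∀ i, (adjugate (B x) * B') i i = ((B x).updateCol i (fun j => B' j i)).det := by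
    intro i
    rw [← cramer_apply, cramer_eq_adjugate_mulVec]
    rfl
  simp only [trace, diag_apply, h2, det_apply', Finset.mul_sum]
  rw [Finset.sum_comm]
  refine Finset.sum_congr rfl fun σ _ => Finset.sum_congr rfl fun i _ => ?_
  rw [← Finset.mul_prod_erase _ _ (Finset.mem_univ i)]
  simp only [updateCol_self, smul_eq_mul]
  congr 1
  rw [mul_comm]
  congr 1
  refine Finset.prod_congr rfl fun j hj => ?_
  rw [updateCol_ne (Finset.ne_of_mem_erase hj)]

section Inverse

open scoped Matrix.Norms.Operator

theorem hasDerivAt_nonsing_inv {n : Type*} [Fintype n] [DecidableEq n] {B : ℝ → Matrix n n ℝ}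
    {B' : Matrix n n ℝ} {x : ℝ} (h : ∀ i j, HasDerivAt (fun t => B t i j) (B' i j) x)
    (h0 : (B x).det ≠ 0) (i j : n) :
    HasDerivAt (fun t => (B t)⁻¹ i j) ((-((B x)⁻¹ * B' * (B x)⁻¹)) i j) x := by
  have hB : HasDerivAt B B' x := hasDerivAt_pi.2 fun i => hasDerivAt_pi.2 fun j => h i j
  have hu : IsUnit (B x) := (isUnit_iff_isUnit_det _).2 (isUnit_iff_ne_zero.2 h0)
  have h1 := hasFDerivAt_ringInverse (𝕜 := ℝ) hu.unit
  rw [hu.unit_spec] at h1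
  have h2 : HasDerivAt (fun t => (B t)⁻¹) _ x :=
    (h1.comp_hasDerivAt x hB).congr_of_eventuallyEq
      (Filter.Eventually.of_forall fun t => nonsing_inv_eq_ringInverse (A := B t))
  refine HasDerivAt.congr_deriv (hasDerivAt_pi.1 (hasDerivAt_pi.1 h2 i) j) ?_
  simp [coe_units_inv]

end Inverse

theorem hasDerivAt_matrix_mul {n : Type*} [Fintype n] {A B : ℝ → Matrix n n ℝ}
    {A' B' : Matrix n n ℝ} {x : ℝ} (hA : ∀ i j, HasDerivAt (fun t => A t i j) (A' i j) x)
    (hB : ∀ i j, HasDerivAt (fun t => B t i j) (B' i j) x) (i j : n) :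
    HasDerivAt (fun t => (A t * B t) i j) ((A' * B x + A x * B') i j) x := by
  simp only [Matrix.add_apply, mul_apply, ← Finset.sum_add_distrib]
  exact HasDerivAt.fun_sum fun k _ => (hA i k).mul (hB k j)

/-! ### The continuous flows -/

theorem hasDerivAt_cauchyMatrix (P Q : Fin N → ℝ) {a : ℝ → Fin N → ℝ} {a' : Fin N → ℝ} {x : ℝ}
    (h : ∀ k, HasDerivAt (fun t => a t k) (a' k) x) (i j : Fin N) :
    HasDerivAt (fun t => cauchyMatrix P Q (a t) i j) (cauchyMatrix P Q a' i j) x := by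
  simp only [cauchyMatrix, of_apply]
  exact (h j).div_const _

/-- At the time `x` the weights `a`, `b` move with the logarithmic velocities
`-κ (1 / (Q - s₁) + 1 / (Q - s₂))` and `κ (1 / (P - s₁) + 1 / (P - s₂))`. Both continuous variables
of the lattice are such times, with `κ = 2 ζ` and `s₁, s₂ = ± ζ` for `ζ = λ` and `ζ = μ`. -/
structure FlowsAt (P Q : Fin N → ℝ) (κ s₁ s₂ : ℝ) (a b : ℝ → Fin N → ℝ) (x : ℝ) : Prop where
  hasDerivAt_left : ∀ k, HasDerivAt (fun t => a t k)
    ((a x * -(κ • (invSub Q s₁ + invSub Q s₂))) k) x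
  hasDerivAt_right : ∀ k, HasDerivAt (fun t => b t k)
    ((b x * (κ • (invSub P s₁ + invSub P s₂))) k) x

/-- The velocity of `1 + A B` under the flow is a commutator plus two matrices of rank one. -/
theorem flow_velocity {P Q : Fin N → ℝ} (h : ∀ j k, P j ≠ Q k) (a b : Fin N → ℝ) {s₁ s₂ : ℝ}
    (hP₁ : ∀ k, P k ≠ s₁) (hP₂ : ∀ k, P k ≠ s₂) (hQ₁ : ∀ k, Q k ≠ s₁) (hQ₂ : ∀ k, Q k ≠ s₂)
    (κ : ℝ) :
    cauchyMatrix P Q (a * -(κ • (invSub Q s₁ + invSub Q s₂))) * cauchyMatrix Q P b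
        + cauchyMatrix P Q a * cauchyMatrix Q P (b * (κ • (invSub P s₁ + invSub P s₂))) =
      κ • (cauchyMatrix P Q a * cauchyMatrix Q P b * diagonal (invSub P s₁ + invSub P s₂)
        - diagonal (invSub P s₁ + invSub P s₂) * (cauchyMatrix P Q a * cauchyMatrix Q P b)
        - vecMulVec (invSub P s₁) (a * invSub Q s₁) * cauchyMatrix Q P b
        - vecMulVec (invSub P s₂) (a * invSub Q s₂) * cauchyMatrix Q P b) := by
  have e1 := cauchyMatrix_mul_diagonal_invSub h a hP₁ hQ₁
  have e2 := cauchyMatrix_mul_diagonal_invSub h a hP₂ hQ₂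
  have d : ∀ R : Fin N → ℝ, diagonal (invSub R s₁ + invSub R s₂)
      = diagonal (invSub R s₁) + diagonal (invSub R s₂) := fun R => by
    rw [diagonal_add]; rfl
  have dn : ∀ g : Fin N → ℝ, diagonal (-g) = -diagonal g := fun g => (diagonal_neg g).symm
  rw [cauchyMatrix_mul_weight, cauchyMatrix_mul_weight, dn, diagonal_smul,
    diagonal_smul, d, d, Matrix.mul_neg, Matrix.mul_smul, Matrix.mul_add, e1, e2,
    Matrix.mul_smul, Matrix.mul_smul, Matrix.neg_mul, Matrix.smul_mul, ← smul_neg, ← smul_add]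
  congr 1
  noncomm_ring

theorem FlowsAt.hasDerivAt_kernel {P Q : Fin N → ℝ} (h : ∀ j k, P j ≠ Q k)
    {κ s₁ s₂ x : ℝ} {a b : ℝ → Fin N → ℝ} (hf : FlowsAt P Q κ s₁ s₂ a b x)
    (hP₁ : ∀ k, P k ≠ s₁) (hP₂ : ∀ k, P k ≠ s₂) (hQ₁ : ∀ k, Q k ≠ s₁) (hQ₂ : ∀ k, Q k ≠ s₂)
    (i j : Fin N) :
    HasDerivAt (fun t => (1 + cauchyMatrix P Q (a t) * cauchyMatrix Q P (b t)) i j)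
      ((κ • (cauchyMatrix P Q (a x) * cauchyMatrix Q P (b x) * diagonal (invSub P s₁ + invSub P s₂)
        - diagonal (invSub P s₁ + invSub P s₂) * (cauchyMatrix P Q (a x) * cauchyMatrix Q P (b x))
        - vecMulVec (invSub P s₁) (a x * invSub Q s₁) * cauchyMatrix Q P (b x)
        - vecMulVec (invSub P s₂) (a x * invSub Q s₂) * cauchyMatrix Q P (b x))) i j) x := by
  rw [← flow_velocity h _ _ hP₁ hP₂ hQ₁ hQ₂]
  exact (hasDerivAt_matrix_mul (hasDerivAt_cauchyMatrix P Q hf.hasDerivAt_left)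
    (hasDerivAt_cauchyMatrix Q P hf.hasDerivAt_right) i j).const_add _

/-- In the logarithmic derivative of the determinant the commutator of `flow_velocity` drops out,
and the terms of rank one leave the diagonal values of `green`. -/
theorem FlowsAt.hasDerivAt_cauchyTau {P Q : Fin N → ℝ} (h : ∀ j k, P j ≠ Q k)
    {κ s₁ s₂ x : ℝ} {a b : ℝ → Fin N → ℝ} (hf : FlowsAt P Q κ s₁ s₂ a b x)
    (h0 : cauchyTau P Q (a x) (b x) ≠ 0)
    (hP₁ : ∀ k, P k ≠ s₁) (hP₂ : ∀ k, P k ≠ s₂) (hQ₁ : ∀ k, Q k ≠ s₁) (hQ₂ : ∀ k, Q k ≠ s₂) :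
    HasDerivAt (fun t => cauchyTau P Q (a t) (b t))
      (cauchyTau P Q (a x) (b x) *
        -(κ * (green P Q (a x) (b x) s₁ s₁ + green P Q (a x) (b x) s₂ s₂))) x := by
  have hu : IsUnit (1 + cauchyMatrix P Q (a x) * cauchyMatrix Q P (b x)).det :=
    isUnit_iff_ne_zero.2 h0
  have hd := hasDerivAt_det (hf.hasDerivAt_kernel h hP₁ hP₂ hQ₁ hQ₂)
  refine HasDerivAt.congr_deriv hd ?_
  have hadj : adjugate (1 + cauchyMatrix P Q (a x) * cauchyMatrix Q P (b x))
      = cauchyTau P Q (a x) (b x) •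
        (1 + cauchyMatrix P Q (a x) * cauchyMatrix Q P (b x))⁻¹ := by
    rw [Matrix.inv_def, smul_smul, cauchyTau, Ring.mul_inverse_cancel _ hu, one_smul]
  rw [hadj, Matrix.smul_mul, trace_smul, smul_eq_mul,
    Matrix.mul_smul, trace_smul, smul_eq_mul]
  simp only [green, resolvent]
  set A := cauchyMatrix P Q (a x)
  set B := cauchyMatrix Q P (b x)
  set S := (1 + A * B)⁻¹
  set D := diagonal (invSub P s₁ + invSub P s₂)
  have hS : S * (A * B) = A * B * S := by
    have e1 : S * (1 + A * B) = 1 := nonsing_inv_mul _ hu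
    have e2 : (1 + A * B) * S = 1 := mul_nonsing_inv _ hu
    rw [Matrix.mul_add, Matrix.mul_one] at e1
    rw [Matrix.add_mul, Matrix.one_mul] at e2
    exact add_left_cancel (e1.trans e2.symm)
  have hcomm : trace (S * (A * B * D)) = trace (S * (D * (A * B))) := by
    rw [← Matrix.mul_assoc, hS, Matrix.mul_assoc (A * B), trace_mul_comm (A * B), Matrix.mul_assoc]
  have hG : ∀ s, trace (S * (vecMulVec (invSub P s) (a x * invSub Q s) * B)) =
      (a x * invSub Q s) ⬝ᵥ ((B * S) *ᵥ invSub P s) := by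
    intro s
    rw [vecMulVec_mul, mul_vecMulVec, trace_vecMulVec, dotProduct_comm, ← dotProduct_mulVec,
      mulVec_mulVec]
  rw [Matrix.mul_sub, Matrix.mul_sub, Matrix.mul_sub, trace_sub, trace_sub, trace_sub, hcomm,
    hG, hG]
  ring

/-- A Riccati equation for the resolvent. -/
theorem FlowsAt.hasDerivAt_resolvent {P Q : Fin N → ℝ} (h : ∀ j k, P j ≠ Q k)
    {κ s₁ s₂ x : ℝ} {a b : ℝ → Fin N → ℝ} (hf : FlowsAt P Q κ s₁ s₂ a b x)
    (h0 : cauchyTau P Q (a x) (b x) ≠ 0)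
    (hP₁ : ∀ k, P k ≠ s₁) (hP₂ : ∀ k, P k ≠ s₂) (hQ₁ : ∀ k, Q k ≠ s₁) (hQ₂ : ∀ k, Q k ≠ s₂)
    (i j : Fin N) :
    HasDerivAt (fun t => resolvent P Q (a t) (b t) i j)
      ((κ • (resolvent P Q (a x) (b x) * diagonal (invSub P s₁ + invSub P s₂)
        + vecMulVec (resolvent P Q (a x) (b x) *ᵥ invSub P s₁)
            ((a x * invSub Q s₁) ᵥ* resolvent P Q (a x) (b x))
        + vecMulVec (resolvent P Q (a x) (b x) *ᵥ invSub P s₂)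
            ((a x * invSub Q s₂) ᵥ* resolvent P Q (a x) (b x)))) i j) x := by
  have hu : IsUnit (1 + cauchyMatrix P Q (a x) * cauchyMatrix Q P (b x)).det :=
    isUnit_iff_ne_zero.2 h0
  have hI := hasDerivAt_nonsing_inv (hf.hasDerivAt_kernel h hP₁ hP₂ hQ₁ hQ₂) h0
  have hd := hasDerivAt_matrix_mul (hasDerivAt_cauchyMatrix Q P hf.hasDerivAt_right) hI i j
  refine HasDerivAt.congr_deriv hd ?_
  refine congrFun (congrFun ?_ i) j
  rw [cauchyMatrix_mul_weight, diagonal_smul,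
    ← mul_vecMulVec, ← mul_vecMulVec, ← vecMulVec_mul, ← vecMulVec_mul]
  have hX : resolvent P Q (a x) (b x)
    = cauchyMatrix Q P (b x) * (1 + cauchyMatrix P Q (a x) * cauchyMatrix Q P (b x))⁻¹ := rfl
  set A := cauchyMatrix P Q (a x)
  set B := cauchyMatrix Q P (b x)
  set X := resolvent P Q (a x) (b x)
  set S := (1 + A * B)⁻¹
  set D := diagonal (invSub P s₁ + invSub P s₂)
  set r₁ := vecMulVec (invSub P s₁) (a x * invSub Q s₁)
  set r₂ := vecMulVec (invSub P s₂) (a x * invSub Q s₂)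
  have e2 : (1 + A * B) * S = 1 := mul_nonsing_inv _ hu
  have e3 : A * B * S = 1 - S := by
    rw [Matrix.add_mul, Matrix.one_mul] at e2
    exact eq_sub_of_add_eq' e2
  have e4 : B * (S * (A * B)) = B - X := by
    have e1 : S * (1 + A * B) = 1 := nonsing_inv_mul _ hu
    rw [Matrix.mul_add, Matrix.mul_one] at e1
    rw [eq_sub_of_add_eq' e1, Matrix.mul_sub, Matrix.mul_one, hX]
  have e5 : B * (S * (A * B * D - D * (A * B) - r₁ * B - r₂ * B) * S) =
      B * D * S - X * D - X * (r₁ * X) - X * (r₂ * X) := by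
    calc _ = B * (S * (A * B)) * D * S - (B * S) * D * (A * B * S) - (B * S) * (r₁ * (B * S))
          - (B * S) * (r₂ * (B * S)) := by noncomm_ring
      _ = _ := by rw [e3, e4, ← hX]; noncomm_ring
  simp only [Matrix.mul_smul, Matrix.smul_mul, Matrix.mul_neg, e5]
  rw [← smul_neg, ← smul_add]
  refine congrArg (fun Z : Matrix (Fin N) (Fin N) ℝ => κ • Z) ?_
  abel

theorem invSub_mul_invSub {R : Fin N → ℝ} {s t : ℝ} (hst : s ≠ t) (hs : ∀ k, R k ≠ s)
    (ht : ∀ k, R k ≠ t) :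
    invSub R s * invSub R t = (t - s)⁻¹ • (invSub R t - invSub R s) := by
  ext k
  have := sub_ne_zero.2 (hs k)
  have := sub_ne_zero.2 (ht k)
  have := sub_ne_zero.2 hst.symm
  simp only [invSub, Pi.mul_apply, Pi.smul_apply, Pi.sub_apply, smul_eq_mul]
  field_simp
  ring

/-- A second flow differentiates the diagonal values of `green` into products
`f s t * f t s` of two-point functions. -/
theorem FlowsAt.hasDerivAt_green {P Q : Fin N → ℝ} (h : ∀ j k, P j ≠ Q k)
    {κ s₁ s₂ x : ℝ} {a b : ℝ → Fin N → ℝ} (hf : FlowsAt P Q κ s₁ s₂ a b x)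
    (h0 : cauchyTau P Q (a x) (b x) ≠ 0)
    (hP₁ : ∀ k, P k ≠ s₁) (hP₂ : ∀ k, P k ≠ s₂) (hQ₁ : ∀ k, Q k ≠ s₁) (hQ₂ : ∀ k, Q k ≠ s₂)
    {t : ℝ} (hPt : ∀ k, P k ≠ t) (hQt : ∀ k, Q k ≠ t) (h₁ : s₁ ≠ t) (h₂ : s₂ ≠ t) :
    HasDerivAt (fun y => green P Q (a y) (b y) t t)
      (κ * ((1 - twoPoint P Q (a x) (b x) s₁ t * twoPoint P Q (a x) (b x) t s₁) / (t - s₁) ^ 2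
        + (1 - twoPoint P Q (a x) (b x) s₂ t * twoPoint P Q (a x) (b x) t s₂) / (t - s₂) ^ 2))
      x := by
  have hX := hf.hasDerivAt_resolvent h h0 hP₁ hP₂ hQ₁ hQ₂
  have hd : HasDerivAt (fun y => green P Q (a y) (b y) t t) _ x :=
    HasDerivAt.fun_sum fun i (_ : i ∈ Finset.univ) =>
      ((hf.hasDerivAt_left i).mul_const (invSub Q t i)).mul
        (HasDerivAt.fun_sum fun j (_ : j ∈ Finset.univ) => (hX i j).mul_const (invSub P t j))
  refine HasDerivAt.congr_deriv hd ?_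
  rw [Finset.sum_add_distrib]
  -- the two sums are the velocities coming from the row `a / (Q - t)` and from the resolvent
  change ((a x * -(κ • (invSub Q s₁ + invSub Q s₂))) * invSub Q t)
      ⬝ᵥ (resolvent P Q (a x) (b x) *ᵥ invSub P t)
    + (a x * invSub Q t) ⬝ᵥ ((κ • (_ : Matrix (Fin N) (Fin N) ℝ)) *ᵥ invSub P t) = _
  have e1 : (a x * -(κ • (invSub Q s₁ + invSub Q s₂))) * invSub Q t =
      (-κ) • ((t - s₁)⁻¹ • (a x * invSub Q t - a x * invSub Q s₁)
        + (t - s₂)⁻¹ • (a x * invSub Q t - a x * invSub Q s₂)) := by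
    rw [← mul_sub, ← mul_sub, ← mul_smul_comm, ← mul_smul_comm,
      ← invSub_mul_invSub h₁ hQ₁ hQt, ← invSub_mul_invSub h₂ hQ₂ hQt]
    ext k
    simp only [Pi.mul_apply, Pi.neg_apply, Pi.smul_apply, Pi.add_apply, smul_eq_mul]
    ring
  have e2 : diagonal (invSub P s₁ + invSub P s₂) *ᵥ invSub P t =
      (t - s₁)⁻¹ • (invSub P t - invSub P s₁) + (t - s₂)⁻¹ • (invSub P t - invSub P s₂) := by
    rw [← invSub_mul_invSub h₁ hP₁ hPt, ← invSub_mul_invSub h₂ hP₂ hPt]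
    ext k
    simp only [mulVec_diagonal, Pi.mul_apply, Pi.add_apply]
    ring
  have ht₁ : t - s₁ ≠ 0 := sub_ne_zero.2 h₁.symm
  have ht₂ : t - s₂ ≠ 0 := sub_ne_zero.2 h₂.symm
  rw [e1, smul_mulVec, add_mulVec, add_mulVec, ← mulVec_mulVec, e2, vecMulVec_mulVec,
    vecMulVec_mulVec]
  simp only [mulVec_add, mulVec_sub, mulVec_smul, add_dotProduct, dotProduct_add, sub_dotProduct,
    dotProduct_sub, smul_dotProduct, dotProduct_smul, smul_eq_mul, MulOpposite.smul_eq_mul_unop,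
    MulOpposite.unop_op, ← dotProduct_mulVec, twoPoint]
  have hG : ∀ s t, (a x * invSub Q s) ⬝ᵥ (resolvent P Q (a x) (b x) *ᵥ invSub P t)
    = green P Q (a x) (b x) s t := fun _ _ => rfl
  simp only [hG]
  field_simp
  ring

/-! ### The algebraic identity -/

/-- The identity behind the bilinear form of the lattice equation, for the values `f i j` of the
two-point function at the four points `λ, -λ, μ, -μ`, with `p = (λ + μ)²` and `q = (λ - μ)²`, so
that `p - q = 4 λ μ`. It holds because the `4 × 4` matrix `f` has rank at most two. -/
theorem twoPoint_bilinear {p q : ℝ} {α₁ α₂ β₁ β₂ : Fin 4 → ℝ} {f : Fin 4 → Fin 4 → ℝ}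
    (hf : ∀ i j, f i j = α₁ i * β₁ j + α₂ i * β₂ j) (h1 : ∀ i, f i i = 1) :
    (p - q) * (p * (f 0 2 * f 2 0 + f 1 3 * f 3 1 - 1)
        + q * (f 1 2 * f 2 1 + f 0 3 * f 3 0 - 1)) =
      (q * (f 1 0 * f 2 3) + (p - q) * (f 1 3 * f 2 0))
          * (q * (f 0 1 * f 3 2) + (p - q) * (f 0 2 * f 3 1))
        - (p * (f 1 0 * f 3 2) - (p - q) * (f 1 2 * f 3 0))
          * (p * (f 0 1 * f 2 3) - (p - q) * (f 0 3 * f 2 1)) := by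
  -- Inserting diagonal entries, equal to 1, makes the identity homogeneous; in that form it is a
  -- polynomial identity in the components of the vectors.
  have hom : (p - q) * (p * (f 0 2 * f 2 0 * (f 1 1 * f 3 3) + f 1 3 * f 3 1 * (f 0 0 * f 2 2)
          - f 0 0 * f 1 1 * (f 2 2 * f 3 3))
        + q * (f 1 2 * f 2 1 * (f 0 0 * f 3 3) + f 0 3 * f 3 0 * (f 1 1 * f 2 2)
          - f 0 0 * f 1 1 * (f 2 2 * f 3 3))) =
      (q * (f 1 0 * f 2 3) + (p - q) * (f 1 3 * f 2 0))
          * (q * (f 0 1 * f 3 2) + (p - q) * (f 0 2 * f 3 1))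
        - (p * (f 1 0 * f 3 2) - (p - q) * (f 1 2 * f 3 0))
          * (p * (f 0 1 * f 2 3) - (p - q) * (f 0 3 * f 2 1)) := by
    simp only [hf]
    ring
  simpa only [h1, mul_one] using hom

/-! ### The tau-function as a determinant with moving weights -/

/-- The diagonal entries of `H_ζ`; those of `H̄_ζ` are obtained by `ζ ↦ -ζ`. -/
def cayley (Q : Fin N → ℝ) (ζ : ℝ) : Fin N → ℝ := fun k => (Q k - ζ) / (Q k + ζ)

/-- The entries `c_k` multiplied by the diagonal entries of the exponential and of the powers in
the definition of `A`; the weights of `Ā` are obtained by `(λ, μ) ↦ (-λ, -μ)`. -/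
def weight (l m : ℝ) (Q c : Fin N → ℝ) (x y : ℝ) (n₁ n₂ : ℤ) : Fin N → ℝ := fun k =>
  c k * Real.exp (x * (cayley Q l k - (cayley Q l k)⁻¹) + y * (cayley Q m k - (cayley Q m k)⁻¹))
    * cayley Q l k ^ (n₁ + n₂) * cayley Q m k ^ (n₂ - n₁)

theorem cayley_ne_zero {Q : Fin N → ℝ} {ζ : ℝ} (h : ∀ k, Q k ≠ ζ) (h' : ∀ k, Q k ≠ -ζ)
    (k : Fin N) : cayley Q ζ k ≠ 0 :=
  div_ne_zero (sub_ne_zero.2 (h k)) (fun h0 => h' k (eq_neg_of_add_eq_zero_left h0))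

theorem diagonal_inv_of_ne_zero {g : Fin N → ℝ} (hg : ∀ k, g k ≠ 0) :
    (diagonal g)⁻¹ = diagonal g⁻¹ := by
  refine inv_eq_right_inv ?_
  rw [diagonal_mul_diagonal, ← diagonal_one]
  congr 1
  ext k
  exact mul_inv_cancel₀ (hg k)

theorem diagonal_zpow_of_ne_zero {g : Fin N → ℝ} (hg : ∀ k, g k ≠ 0) (n : ℤ) :
    diagonal g ^ n = diagonal (g ^ n) := by
  cases n with
  | ofNat n =>
    rw [Int.ofNat_eq_natCast, zpow_natCast, zpow_natCast, diagonal_pow]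
  | negSucc n =>
    rw [zpow_negSucc, DivInvMonoid.zpow_neg', diagonal_pow]
    refine (diagonal_inv_of_ne_zero fun k => pow_ne_zero _ (hg k)).trans ?_
    rfl

theorem H_eq_diagonal {Q : Fin N → ℝ} {ζ : ℝ} (h' : ∀ k, Q k ≠ -ζ) :
    H Q ζ = diagonal (cayley Q ζ) := by
  have h1 : diagonal Q - ζ • (1 : Matrix (Fin N) (Fin N) ℝ) = diagonal (fun k => Q k - ζ) := by
    rw [smul_one_eq_diagonal, diagonal_sub]
  have h2 : diagonal Q + ζ • (1 : Matrix (Fin N) (Fin N) ℝ) = diagonal (fun k => Q k + ζ) := by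
    rw [smul_one_eq_diagonal, diagonal_add]
  rw [H, h1, h2, diagonal_inv_of_ne_zero fun k h0 => h' k (eq_neg_of_add_eq_zero_left h0),
    diagonal_mul_diagonal]
  rfl

theorem A_eq_cauchyMatrix {l m : ℝ} {Q : Fin N → ℝ} (hl : ∀ k, Q k ≠ l) (hl' : ∀ k, Q k ≠ -l)
    (hm : ∀ k, Q k ≠ m) (hm' : ∀ k, Q k ≠ -m) (P c : Fin N → ℝ) (x y : ℝ) (n₁ n₂ : ℤ) :
    A l m Q P c x y n₁ n₂ = cauchyMatrix P Q (weight l m Q c x y n₁ n₂) := by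
  have hL : x • L Q l + y • L Q m = diagonal (fun k => x * (cayley Q l k - (cayley Q l k)⁻¹)
      + y * (cayley Q m k - (cayley Q m k)⁻¹)) := by
    rw [L, L, H_eq_diagonal hl', H_eq_diagonal hm', diagonal_inv_of_ne_zero (cayley_ne_zero hl hl'),
      diagonal_inv_of_ne_zero (cayley_ne_zero hm hm'), diagonal_sub, diagonal_sub,
      ← diagonal_smul, ← diagonal_smul, diagonal_add]
    rfl
  rw [A, hL, exp_diagonal, H_eq_diagonal hl', H_eq_diagonal hm',
    diagonal_zpow_of_ne_zero (cayley_ne_zero hl hl'),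
    diagonal_zpow_of_ne_zero (cayley_ne_zero hm hm')]
  ext j k
  simp only [mul_diagonal, cauchyMatrix, of_apply, weight, Pi.coe_exp, Pi.pow_apply,
    ← Real.exp_eq_exp_ℝ]
  ring

theorem Hbar_eq (P : Fin N → ℝ) (ζ : ℝ) : Hbar P ζ = H P (-ζ) := by
  rw [Hbar, H, neg_smul, sub_neg_eq_add, ← sub_eq_add_neg]

theorem Abar_eq (l m : ℝ) (Q P c : Fin N → ℝ) (x y : ℝ) (n₁ n₂ : ℤ) :
    Abar l m Q P c x y n₁ n₂ = A (-l) (-m) P Q c x y n₁ n₂ := by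
  simp only [Abar, A, Lbar, L, Hbar_eq]

/-- No node lies at one of the points `± l`, `± m`. -/
structure Admissible (l m : ℝ) (Q : Fin N → ℝ) : Prop where
  ne_l : ∀ k, Q k ≠ l
  ne_neg_l : ∀ k, Q k ≠ -l
  ne_m : ∀ k, Q k ≠ m
  ne_neg_m : ∀ k, Q k ≠ -m

theorem Admissible.neg {l m : ℝ} {Q : Fin N → ℝ} (h : Admissible l m Q) :
    Admissible (-l) (-m) Q :=
  ⟨h.ne_neg_l, by simpa using h.ne_l, h.ne_neg_m, by simpa using h.ne_m⟩

theorem tau_eq_cauchyTau {l m : ℝ} {Q P : Fin N → ℝ} (hQ : Admissible l m Q)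
    (hP : Admissible l m P) (c c' : Fin N → ℝ) (x y : ℝ) (n₁ n₂ : ℤ) :
    tau l m Q P c c' x y n₁ n₂ =
      cauchyTau P Q (weight l m Q c x y n₁ n₂) (weight (-l) (-m) P c' x y n₁ n₂) := by
  rw [tau, cauchyTau, Abar_eq, A_eq_cauchyMatrix hQ.ne_l hQ.ne_neg_l hQ.ne_m hQ.ne_neg_m,
    A_eq_cauchyMatrix hP.neg.ne_l hP.neg.ne_neg_l hP.neg.ne_m hP.neg.ne_neg_m]

theorem cayley_sub_inv {Q : Fin N → ℝ} {ζ : ℝ} (h : ∀ k, Q k ≠ ζ) (h' : ∀ k, Q k ≠ -ζ)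
    (k : Fin N) : cayley Q ζ k - (cayley Q ζ k)⁻¹
      = -(2 * ζ * (invSub Q ζ k + invSub Q (-ζ) k)) := by
  have h1 := sub_ne_zero.2 (h k)
  have h2 : Q k + ζ ≠ 0 := fun h0 => h' k (eq_neg_of_add_eq_zero_left h0)
  simp only [cayley, invSub, sub_neg_eq_add]
  field_simp
  ring

section WeightShift

variable {l m : ℝ} {Q : Fin N → ℝ} (c : Fin N → ℝ) (x y : ℝ) (n₁ n₂ : ℤ)

theorem weight_add_one_left (hQ : Admissible l m Q) :
    weight l m Q c x y (n₁ + 1) n₂ = weight l m Q c x y n₁ n₂ *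
    fun k => (Q k - l) * (Q k - -m) / ((Q k - -l) * (Q k - m)) := by
  ext k
  have h1 := cayley_ne_zero hQ.ne_l hQ.ne_neg_l k
  have h2 := cayley_ne_zero hQ.ne_m hQ.ne_neg_m k
  have e : (Q k - l) * (Q k - -m) / ((Q k - -l) * (Q k - m))
      = cayley Q l k * (cayley Q m k)⁻¹ := by
    simp only [cayley, sub_neg_eq_add, inv_div, div_mul_div_comm]
  rw [Pi.mul_apply, e, weight, weight, show n₁ + 1 + n₂ = n₁ + n₂ + 1 by ring,
    show n₂ - (n₁ + 1) = n₂ - n₁ - 1 by ring, zpow_add_one₀ h1, zpow_sub_one₀ h2]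
  ring

theorem weight_sub_one_left (hQ : Admissible l m Q) :
    weight l m Q c x y (n₁ - 1) n₂ = weight l m Q c x y n₁ n₂ *
    fun k => (Q k - -l) * (Q k - m) / ((Q k - l) * (Q k - -m)) := by
  ext k
  have h1 := cayley_ne_zero hQ.ne_l hQ.ne_neg_l k
  have h2 := cayley_ne_zero hQ.ne_m hQ.ne_neg_m k
  have e : (Q k - -l) * (Q k - m) / ((Q k - l) * (Q k - -m))
      = (cayley Q l k)⁻¹ * cayley Q m k := by
    simp only [cayley, sub_neg_eq_add, inv_div, div_mul_div_comm]
  rw [Pi.mul_apply, e, weight, weight, show n₁ - 1 + n₂ = n₁ + n₂ - 1 by ring,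
    show n₂ - (n₁ - 1) = n₂ - n₁ + 1 by ring, zpow_sub_one₀ h1, zpow_add_one₀ h2]
  ring

theorem weight_add_one_right (hQ : Admissible l m Q) :
    weight l m Q c x y n₁ (n₂ + 1) = weight l m Q c x y n₁ n₂ *
    fun k => (Q k - l) * (Q k - m) / ((Q k - -l) * (Q k - -m)) := by
  ext k
  have h1 := cayley_ne_zero hQ.ne_l hQ.ne_neg_l k
  have h2 := cayley_ne_zero hQ.ne_m hQ.ne_neg_m k
  have e : (Q k - l) * (Q k - m) / ((Q k - -l) * (Q k - -m))
      = cayley Q l k * cayley Q m k := by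
    simp only [cayley, sub_neg_eq_add, div_mul_div_comm]
  rw [Pi.mul_apply, e, weight, weight, show n₁ + (n₂ + 1) = n₁ + n₂ + 1 by ring,
    show n₂ + 1 - n₁ = n₂ - n₁ + 1 by ring, zpow_add_one₀ h1, zpow_add_one₀ h2]
  ring

theorem weight_sub_one_right (hQ : Admissible l m Q) :
    weight l m Q c x y n₁ (n₂ - 1) = weight l m Q c x y n₁ n₂ *
    fun k => (Q k - -l) * (Q k - -m) / ((Q k - l) * (Q k - m)) := by
  ext k
  have h1 := cayley_ne_zero hQ.ne_l hQ.ne_neg_l k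
  have h2 := cayley_ne_zero hQ.ne_m hQ.ne_neg_m k
  have e : (Q k - -l) * (Q k - -m) / ((Q k - l) * (Q k - m))
      = (cayley Q l k)⁻¹ * (cayley Q m k)⁻¹ := by
    simp only [cayley, sub_neg_eq_add, inv_div, div_mul_div_comm]
  rw [Pi.mul_apply, e, weight, weight, show n₁ + (n₂ - 1) = n₁ + n₂ - 1 by ring,
    show n₂ - 1 - n₁ = n₂ - n₁ - 1 by ring, zpow_sub_one₀ h1, zpow_sub_one₀ h2]
  ring

end WeightShift

theorem flowsAt_weight_x {l m : ℝ} {Q P : Fin N → ℝ} (hQ : Admissible l m Q)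
    (hP : Admissible l m P) (c c' : Fin N → ℝ) (x y : ℝ) (n₁ n₂ : ℤ) :
    FlowsAt P Q (2 * l) l (-l) (fun s => weight l m Q c s y n₁ n₂)
      (fun s => weight (-l) (-m) P c' s y n₁ n₂) x := by
  have key : ∀ (l m : ℝ) (R c : Fin N → ℝ) (k : Fin N),
      HasDerivAt (fun s => weight l m R c s y n₁ n₂ k)
        (weight l m R c x y n₁ n₂ k * (cayley R l k - (cayley R l k)⁻¹)) x := by
    intro l m R c k
    have h1 := ((((((hasDerivAt_id x).mul_const (cayley R l k - (cayley R l k)⁻¹)).add_const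
      (y * (cayley R m k - (cayley R m k)⁻¹))).exp.const_mul (c k)).mul_const
        (cayley R l k ^ (n₁ + n₂))).mul_const (cayley R m k ^ (n₂ - n₁)))
    refine HasDerivAt.congr_deriv h1 ?_
    simp only [weight, id_eq]
    ring
  refine ⟨fun k => (key l m Q c k).congr_deriv ?_, fun k => (key (-l) (-m) P c' k).congr_deriv ?_⟩
  · rw [cayley_sub_inv hQ.ne_l hQ.ne_neg_l]
    rfl
  · rw [cayley_sub_inv hP.neg.ne_l hP.neg.ne_neg_l, neg_neg]
    simp only [Pi.mul_apply, Pi.smul_apply, Pi.add_apply, smul_eq_mul]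
    ring

/-- Exchanging `l` and `m` exchanges `x` and `y` and reflects `n₁`. -/
theorem weight_swap (l m : ℝ) (Q c : Fin N → ℝ) (x y : ℝ) (n₁ n₂ : ℤ) :
    weight l m Q c x y n₁ n₂ = weight m l Q c y x (-n₁) n₂ := by
  ext k
  rw [weight, weight, show -n₁ + n₂ = n₂ - n₁ by ring, show n₂ - -n₁ = n₁ + n₂ by ring,
    add_comm (x * _)]
  ring

theorem flowsAt_weight_y {l m : ℝ} {Q P : Fin N → ℝ} (hQ : Admissible l m Q)
    (hP : Admissible l m P) (c c' : Fin N → ℝ) (x y : ℝ) (n₁ n₂ : ℤ) :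
    FlowsAt P Q (2 * m) m (-m) (fun t => weight l m Q c x t n₁ n₂)
      (fun t => weight (-l) (-m) P c' x t n₁ n₂) y := by
  simp only [weight_swap l m, weight_swap (-l) (-m)]
  exact flowsAt_weight_x ⟨hQ.ne_m, hQ.ne_neg_m, hQ.ne_l, hQ.ne_neg_l⟩
    ⟨hP.ne_m, hP.ne_neg_m, hP.ne_l, hP.ne_neg_l⟩ ..

/-! ### The lattice equation -/

/-- The lattice equation in terms of `τ`: the function differentiated here is `∂_y ln τ`. -/
theorem tau_bilinear {l m : ℝ} (hlm : l ≠ m) (hlm' : l ≠ -m) {Q P : Fin N → ℝ}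
    (hQ : Admissible l m Q) (hP : Admissible l m P) (hPQ : ∀ j k, P j ≠ Q k)
    (c c' : Fin N → ℝ) (x y : ℝ) (n₁ n₂ : ℤ) (h0 : tau l m Q P c c' x y n₁ n₂ ≠ 0) :
    ∃ v : ℝ, HasDerivAt (fun s => -(2 * m *
        (green P Q (weight l m Q c s y n₁ n₂) (weight (-l) (-m) P c' s y n₁ n₂) m m
        + green P Q (weight l m Q c s y n₁ n₂) (weight (-l) (-m) P c' s y n₁ n₂) (-m) (-m)))) v x ∧
      8 * (l * m * (l ^ 2 + m ^ 2) / (l ^ 2 - m ^ 2) ^ 2) + v =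
        ((l + m) / (l - m)) ^ 2 * (tau l m Q P c c' x y (n₁ + 1) n₂
            * tau l m Q P c c' x y (n₁ - 1) n₂ / tau l m Q P c c' x y n₁ n₂ ^ 2)
        - (((l + m) / (l - m)) ^ 2)⁻¹ * (tau l m Q P c c' x y n₁ (n₂ + 1)
            * tau l m Q P c c' x y n₁ (n₂ - 1) / tau l m Q P c c' x y n₁ n₂ ^ 2) := by
  have hd : l - m ≠ 0 := sub_ne_zero.2 hlm
  have hs : l + m ≠ 0 := fun h => hlm' (eq_neg_of_add_eq_zero_left h)
  have hml : -l ≠ m := fun h => hlm' (by rw [← h, neg_neg])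
  have hnn : -l ≠ -m := fun h => hlm (neg_injective h)
  have hf := flowsAt_weight_x hQ hP c c' x y n₁ n₂
  simp only [tau_eq_cauchyTau hQ hP] at h0 ⊢
  rw [weight_add_one_left _ _ _ _ _ hQ, weight_add_one_left _ _ _ _ _ hP.neg,
    weight_sub_one_left _ _ _ _ _ hQ, weight_sub_one_left _ _ _ _ _ hP.neg,
    weight_add_one_right _ _ _ _ _ hQ, weight_add_one_right _ _ _ _ _ hP.neg,
    weight_sub_one_right _ _ _ _ _ hQ, weight_sub_one_right _ _ _ _ _ hP.neg]
  simp only [neg_neg]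
  have g1 := hf.hasDerivAt_green hPQ h0 hP.ne_l hP.ne_neg_l hQ.ne_l hQ.ne_neg_l hP.ne_m hQ.ne_m
    hlm hml
  have g2 := hf.hasDerivAt_green hPQ h0 hP.ne_l hP.ne_neg_l hQ.ne_l hQ.ne_neg_l hP.ne_neg_m
    hQ.ne_neg_m hlm' hnn
  refine ⟨_, ((g1.add g2).const_mul (2 * m)).neg, ?_⟩
  have t1 := cauchyTau_shift hPQ h0 hlm' hml hP.ne_l hP.ne_neg_m hP.ne_neg_l hP.ne_m
    hQ.ne_neg_l hQ.ne_m
  have t2 := cauchyTau_shift hPQ h0 hml hlm' hP.ne_neg_l hP.ne_m hP.ne_l hP.ne_neg_m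
    hQ.ne_l hQ.ne_neg_m
  have t3 := cauchyTau_shift hPQ h0 hlm hnn hP.ne_l hP.ne_m hP.ne_neg_l hP.ne_neg_m
    hQ.ne_neg_l hQ.ne_neg_m
  have t4 := cauchyTau_shift hPQ h0 hnn hlm hP.ne_neg_l hP.ne_neg_m hP.ne_l hP.ne_m
    hQ.ne_l hQ.ne_m
  obtain ⟨α₁, α₂, β₁, β₂, hfac⟩ := twoPoint_factor hPQ h0
  set a := weight l m Q c x y n₁ n₂
  set b := weight (-l) (-m) P c' x y n₁ n₂
  set pt : Fin 4 → ℝ := ![l, -l, m, -m] with hpt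
  have hQpt : ∀ i k, Q k ≠ pt i := by
    intro i k
    fin_cases i
    exacts [hQ.ne_l k, hQ.ne_neg_l k, hQ.ne_m k, hQ.ne_neg_m k]
  have hPpt : ∀ i k, P k ≠ pt i := by
    intro i k
    fin_cases i
    exacts [hP.ne_l k, hP.ne_neg_l k, hP.ne_m k, hP.ne_neg_m k]
  have hbil := twoPoint_bilinear (p := (l + m) ^ 2) (q := (l - m) ^ 2)
    (f := fun i j => twoPoint P Q a b (pt i) (pt j))
    (α₁ := fun i => α₁ (pt i)) (α₂ := fun i => α₂ (pt i))
    (β₁ := fun i => β₁ (pt i)) (β₂ := fun i => β₂ (pt i))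
    (fun i j => hfac _ _ (hQpt i) (hPpt j)) (fun i => by simp [twoPoint])
  have p0 : pt 0 = l := rfl
  have p1 : pt 1 = -l := rfl
  have p2 : pt 2 = m := rfl
  have p3 : pt 3 = -m := rfl
  simp only [p0, p1, p2, p3] at hbil
  rw [← eq_div_iff (mul_ne_zero (sub_ne_zero.2 hml) (sub_ne_zero.2 hlm'.symm))] at t1
  rw [← eq_div_iff (mul_ne_zero (sub_ne_zero.2 hlm') (sub_ne_zero.2 hml.symm))] at t2
  rw [← eq_div_iff (mul_ne_zero (sub_ne_zero.2 hnn) (sub_ne_zero.2 hlm.symm))] at t3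
  rw [← eq_div_iff (mul_ne_zero (sub_ne_zero.2 hlm) (sub_ne_zero.2 hnn.symm))] at t4
  rw [t1, t2, t3, t4]
  have e1 : (-l - m) * (-m - l) = (l + m) ^ 2 := by ring
  have e2 : (l - -m) * (m - -l) = (l + m) ^ 2 := by ring
  have e3 : (-l - -m) * (m - l) = (l - m) ^ 2 := by ring
  have e4 : (l - m) * (-m - -l) = (l - m) ^ 2 := by ring
  have e5 : l ^ 2 - m ^ 2 = (l + m) * (l - m) := by ring
  have e6 : (m - l) ^ 2 = (l - m) ^ 2 := by ring
  have e7 : (m - -l) ^ 2 = (l + m) ^ 2 := by ring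
  have e8 : (-m - l) ^ 2 = (l + m) ^ 2 := by ring
  have e9 : (-m - -l) ^ 2 = (l - m) ^ 2 := by ring
  rw [e1, e2, e3, e4, e5, e6, e7, e8, e9]
  generalize cauchyTau P Q a b = T at *
  generalize twoPoint P Q a b = f at *
  field_simp
  linear_combination hbil

theorem contDiff_tau {l m : ℝ} {Q P : Fin N → ℝ} (hQ : Admissible l m Q)
    (hP : Admissible l m P) (c c' : Fin N → ℝ) (n₁ n₂ : ℤ) :
    ContDiff ℝ ∞ (fun p : ℝ × ℝ => tau l m Q P c c' p.1 p.2 n₁ n₂) := by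
  simp only [tau_eq_cauchyTau hQ hP, cauchyTau, det_apply', Matrix.add_apply, mul_apply,
    cauchyMatrix, of_apply, weight]
  refine ContDiff.sum fun σ _ => contDiff_const.mul (contDiff_prod fun i _ => ?_)
  refine contDiff_const.add (ContDiff.sum fun k _ => ?_)
  fun_prop

theorem contDiff_phi (l m : ℝ) (n₁ n₂ : ℤ) :
    ContDiff ℝ ∞ (fun p : ℝ × ℝ => phi l m p.1 p.2 n₁ n₂) := by
  unfold phi
  fun_prop

theorem hasDerivAt_tau {l m : ℝ} {Q P : Fin N → ℝ} (hQ : Admissible l m Q)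
    (hP : Admissible l m P) (hPQ : ∀ j k, P j ≠ Q k) (c c' : Fin N → ℝ) (x y : ℝ) (n₁ n₂ : ℤ)
    (h0 : tau l m Q P c c' x y n₁ n₂ ≠ 0) :
    HasDerivAt (fun t => tau l m Q P c c' x t n₁ n₂) (tau l m Q P c c' x y n₁ n₂ * -(2 * m *
      (green P Q (weight l m Q c x y n₁ n₂) (weight (-l) (-m) P c' x y n₁ n₂) m m
      + green P Q (weight l m Q c x y n₁ n₂) (weight (-l) (-m) P c' x y n₁ n₂) (-m) (-m)))) y := by
  simp only [tau_eq_cauchyTau hQ hP] at h0 ⊢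
  exact (flowsAt_weight_y hQ hP c c' x y n₁ n₂).hasDerivAt_cauchyTau hPQ h0 hP.ne_m hP.ne_neg_m
    hQ.ne_m hQ.ne_neg_m

theorem hasDerivAt_phi (l m x y : ℝ) (n₁ n₂ : ℤ) :
    HasDerivAt (fun t => phi l m x t n₁ n₂)
      (x * (8 * (l * m * (l ^ 2 + m ^ 2) / (l ^ 2 - m ^ 2) ^ 2))) y := by
  unfold phi
  refine HasDerivAt.congr_deriv ((((hasDerivAt_id y).const_mul (8 * x)).mul_const _).add_const _) ?_
  ring

/-- For nonvanishing `τ` of either sign, `φ + ln |τ|` has the mixed derivative that the lattice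
equation prescribes; recall that `Real.log` is `ln |·|`. -/
theorem exists_mixed_deriv {l m : ℝ} (hlm : l ≠ m) (hlm' : l ≠ -m) {Q P : Fin N → ℝ}
    (hQ : Admissible l m Q) (hP : Admissible l m P) (hPQ : ∀ j k, P j ≠ Q k)
    (c c' : Fin N → ℝ) (x y : ℝ) (n₁ n₂ : ℤ) (h0 : tau l m Q P c c' x y n₁ n₂ ≠ 0) :
    ∃ w : ℝ → ℝ,
      (∀ᶠ s in nhds x, tau l m Q P c c' s y n₁ n₂ ≠ 0 ∧
        HasDerivAt (fun t => phi l m s t n₁ n₂ + Real.log (tau l m Q P c c' s t n₁ n₂)) (w s) y) ∧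
      HasDerivAt w (((l + m) / (l - m)) ^ 2 * (tau l m Q P c c' x y (n₁ + 1) n₂
            * tau l m Q P c c' x y (n₁ - 1) n₂ / tau l m Q P c c' x y n₁ n₂ ^ 2)
        - (((l + m) / (l - m)) ^ 2)⁻¹ * (tau l m Q P c c' x y n₁ (n₂ + 1)
            * tau l m Q P c c' x y n₁ (n₂ - 1) / tau l m Q P c c' x y n₁ n₂ ^ 2)) x := by
  obtain ⟨v, hv, hv'⟩ := tau_bilinear hlm hlm' hQ hP hPQ c c' x y n₁ n₂ h0
  have hcont : Continuous fun s => tau l m Q P c c' s y n₁ n₂ := by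
    have h := (contDiff_tau hQ hP c c' n₁ n₂).continuous
    exact h.along_fst
  have h1 : HasDerivAt (fun s : ℝ => s * (8 * (l * m * (l ^ 2 + m ^ 2) / (l ^ 2 - m ^ 2) ^ 2)))
      (8 * (l * m * (l ^ 2 + m ^ 2) / (l ^ 2 - m ^ 2) ^ 2)) x :=
    hasDerivAt_mul_const _
  have h3 := h1.add hv
  rw [hv'] at h3
  refine ⟨fun s => s * (8 * (l * m * (l ^ 2 + m ^ 2) / (l ^ 2 - m ^ 2) ^ 2)) + -(2 * m *
        (green P Q (weight l m Q c s y n₁ n₂) (weight (-l) (-m) P c' s y n₁ n₂) m m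
        + green P Q (weight l m Q c s y n₁ n₂) (weight (-l) (-m) P c' s y n₁ n₂) (-m) (-m))),
    ?_, h3⟩
  filter_upwards [hcont.continuousAt.eventually_ne h0] with s hs
  refine ⟨hs, ?_⟩
  have h2 := (hasDerivAt_tau hQ hP hPQ c c' s y n₁ n₂ hs).log hs
  rw [mul_div_cancel_left₀ _ hs] at h2
  exact (hasDerivAt_phi l m s y n₁ n₂).add h2

/-- Although the principal logarithm jumps across the negative half-axis, along a real function it
differs from `ln |·|` by a locally constant term. -/
theorem eventually_clog_ofReal {X : Type*} [TopologicalSpace X] {f : X → ℝ} {z : X}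
    (hf : ContinuousAt f z) (h0 : f z ≠ 0) :
    ∀ᶠ p in nhds z, Complex.log (f p) =
      ((Real.log (f p) : ℝ) : ℂ) + ((f z : ℂ).arg : ℂ) * Complex.I := by
  have hsign : ∀ᶠ p in nhds z, (f p : ℂ).arg = (f z : ℂ).arg := by
    rcases lt_or_gt_of_ne h0 with h | h
    · filter_upwards [hf.eventually_lt_const h] with p hp
      rw [Complex.arg_ofReal_of_neg hp, Complex.arg_ofReal_of_neg h]
    · filter_upwards [hf.eventually_const_lt h] with p hp
      rw [Complex.arg_ofReal_of_nonneg hp.le, Complex.arg_ofReal_of_nonneg h.le]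
  filter_upwards [hsign] with p hp
  rw [Complex.log, hp, Complex.norm_real, Real.norm_eq_abs, Real.log_abs]

theorem exp_two_mul_log_abs {r : ℝ} (hr : r ≠ 0) : Real.exp (2 * Real.log |r|) = r ^ 2 := by
  rw [two_mul, Real.exp_add, Real.exp_log (abs_pos.2 hr), abs_mul_abs_self, sq]

theorem lap₁_phi (l m x y : ℝ) (n₁ n₂ : ℤ) :
    lap₁ (phi l m x y) n₁ n₂ = 2 * Real.log |(l + m) / (l - m)| := by
  simp only [lap₁, phi]
  push_cast
  ring

theorem lap₂_phi (l m x y : ℝ) (n₁ n₂ : ℤ) :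
    lap₂ (phi l m x y) n₁ n₂ = -(2 * Real.log |(l + m) / (l - m)|) := by
  simp only [lap₂, phi]
  push_cast
  ring

theorem exp_second_difference {p₀ p₁ p₂ z₀ z₁ z₂ : ℝ} (h₀ : 0 < z₀) (h₁ : 0 < z₁)
    (h₂ : 0 < z₂) :
    Real.exp (p₁ + Real.log z₁ - 2 * (p₀ + Real.log z₀) + (p₂ + Real.log z₂)) =
      Real.exp (p₁ - 2 * p₀ + p₂) * (z₁ * z₂ / z₀ ^ 2) := by
  rw [show p₁ + Real.log z₁ - 2 * (p₀ + Real.log z₀) + (p₂ + Real.log z₂)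
      = p₁ - 2 * p₀ + p₂ + (Real.log z₁ + Real.log z₂ - (Real.log z₀ + Real.log z₀)) by ring,
    Real.exp_add (p₁ - 2 * p₀ + p₂), Real.exp_sub, Real.exp_add (Real.log z₁),
    Real.exp_add (Real.log z₀), Real.exp_log h₀, Real.exp_log h₁,
    Real.exp_log h₂, sq]

theorem cexp_second_difference {p₀ p₁ p₂ z₀ z₁ z₂ : ℂ} (h₀ : z₀ ≠ 0) (h₁ : z₁ ≠ 0)
    (h₂ : z₂ ≠ 0) :
    Complex.exp (p₁ + Complex.log z₁ - 2 * (p₀ + Complex.log z₀) + (p₂ + Complex.log z₂)) =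
      Complex.exp (p₁ - 2 * p₀ + p₂) * (z₁ * z₂ / z₀ ^ 2) := by
  rw [show p₁ + Complex.log z₁ - 2 * (p₀ + Complex.log z₀) + (p₂ + Complex.log z₂)
      = p₁ - 2 * p₀ + p₂ + (Complex.log z₁ + Complex.log z₂ - (Complex.log z₀ + Complex.log z₀))
      by ring,
    Complex.exp_add (p₁ - 2 * p₀ + p₂), Complex.exp_sub, Complex.exp_add (Complex.log z₁),
    Complex.exp_add (Complex.log z₀), Complex.exp_log h₀,
    Complex.exp_log h₁, Complex.exp_log h₂, sq]

theorem solvesAt_soliton {l m : ℝ} (hlm : l ≠ m) (hlm' : l ≠ -m) {Q P : Fin N → ℝ}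
    (hQ : Admissible l m Q) (hP : Admissible l m P) (hPQ : ∀ j k, P j ≠ Q k)
    (c c' : Fin N → ℝ) (x y : ℝ) (n₁ n₂ : ℤ)
    (h : OnStencil (fun k₁ k₂ => 0 < tau l m Q P c c' x y k₁ k₂) n₁ n₂) :
    SolvesAt (soliton l m Q P c c') x y n₁ n₂ := by
  obtain ⟨h0, h1, h2, h3, h4⟩ := h
  have hr : (l + m) / (l - m) ≠ 0 := div_ne_zero
    (fun h => hlm' (eq_neg_of_add_eq_zero_left h)) (sub_ne_zero.2 hlm)
  refine ⟨(contDiff_phi l m n₁ n₂).contDiffAt.add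
    ((contDiff_tau hQ hP c c' n₁ n₂).contDiffAt.log h0.ne'), ?_⟩
  obtain ⟨w, hw, hw'⟩ := exists_mixed_deriv hlm hlm' hQ hP hPQ c c' x y n₁ n₂ h0.ne'
  have e : (fun s => deriv (fun t => soliton l m Q P c c' s t n₁ n₂) y) =ᶠ[nhds x] w :=
    hw.mono fun s hs => hs.2.deriv
  rw [e.deriv_eq, hw'.deriv, ← exp_two_mul_log_abs hr, ← Real.exp_neg,
    ← lap₂_phi l m x y n₁ n₂, ← lap₁_phi l m x y n₁ n₂, lap₁, lap₁, lap₂, lap₂]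
  simp only [soliton]
  rw [exp_second_difference h0 h1 h2, exp_second_difference h0 h3 h4]

theorem complexSolvesAt_complexSoliton {l m : ℝ} (hlm : l ≠ m) (hlm' : l ≠ -m)
    {Q P : Fin N → ℝ}
    (hQ : Admissible l m Q) (hP : Admissible l m P) (hPQ : ∀ j k, P j ≠ Q k)
    (c c' : Fin N → ℝ) (x y : ℝ) (n₁ n₂ : ℤ)
    (h : OnStencil (fun k₁ k₂ => tau l m Q P c c' x y k₁ k₂ ≠ 0) n₁ n₂) :
    ComplexSolvesAt (complexSoliton l m Q P c c') x y n₁ n₂ := by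
  obtain ⟨h0, h1, h2, h3, h4⟩ := h
  have hr : (l + m) / (l - m) ≠ 0 := div_ne_zero
    (fun h => hlm' (eq_neg_of_add_eq_zero_left h)) (sub_ne_zero.2 hlm)
  have hτ := contDiff_tau hQ hP c c' n₁ n₂
  constructor
  · have hreal : ContDiffAt ℝ ∞ (fun p : ℝ × ℝ => ((phi l m p.1 p.2 n₁ n₂
        + Real.log (tau l m Q P c c' p.1 p.2 n₁ n₂) : ℝ) : ℂ)) (x, y) :=
      Complex.ofRealCLM.contDiff.contDiffAt.comp (x, y)
        ((contDiff_phi l m n₁ n₂).contDiffAt.add (hτ.contDiffAt.log h0))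
    refine (hreal.add (contDiffAt_const
      (c := ((tau l m Q P c c' x y n₁ n₂ : ℂ).arg : ℂ) * Complex.I))).congr_of_eventuallyEq ?_
    filter_upwards [eventually_clog_ofReal hτ.continuous.continuousAt
      (show tau l m Q P c c' (x, y).1 (x, y).2 n₁ n₂ ≠ 0 from h0)] with p hp
    rw [complexSoliton, hp]
    push_cast
    ring
  · obtain ⟨w, hw, hw'⟩ := exists_mixed_deriv hlm hlm' hQ hP hPQ c c' x y n₁ n₂ h0
    have e : (fun s => deriv (fun t => complexSoliton l m Q P c c' s t n₁ n₂) y)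
        =ᶠ[nhds x] fun s => (w s : ℂ) := by
      refine hw.mono fun s hs => ?_
      have hc : ContinuousAt (fun t => tau l m Q P c c' s t n₁ n₂) y :=
        hτ.continuous.along_snd.continuousAt
      refine HasDerivAt.deriv ((hs.2.ofReal_comp.add_const
        (((tau l m Q P c c' s y n₁ n₂ : ℂ).arg : ℂ) * Complex.I)).congr_of_eventuallyEq ?_)
      filter_upwards [eventually_clog_ofReal hc hs.1] with t ht
      rw [complexSoliton, ht]
      push_cast
      ring
    rw [e.deriv_eq, hw'.ofReal_comp.deriv, ← exp_two_mul_log_abs hr, ← Real.exp_neg,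
      ← lap₂_phi l m x y n₁ n₂, ← lap₁_phi l m x y n₁ n₂, lap₁, lap₁, lap₂, lap₂]
    simp only [complexSoliton]
    rw [cexp_second_difference (Complex.ofReal_ne_zero.2 h0) (Complex.ofReal_ne_zero.2 h1)
      (Complex.ofReal_ne_zero.2 h2), cexp_second_difference (Complex.ofReal_ne_zero.2 h0)
      (Complex.ofReal_ne_zero.2 h3) (Complex.ofReal_ne_zero.2 h4)]
    push_cast
    rfl

end Toda22

end

theorem theorem1 (N : ℕ) (l m : ℝ) (M M' c c' : Fin N → ℝ)
    (hlm : l ≠ m) (hlm' : l ≠ -m)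
    (hMM' : ∀ j k, M j ≠ M' k)
    (hMl : ∀ j, M j ≠ l ∧ M j ≠ -l) (hMm : ∀ j, M j ≠ m ∧ M j ≠ -m)
    (hMl' : ∀ j, M' j ≠ l ∧ M' j ≠ -l) (hMm' : ∀ j, M' j ≠ m ∧ M' j ≠ -m) :
    (∀ (x y : ℝ) (n₁ n₂ : ℤ),
      Toda22.OnStencil (fun k₁ k₂ => 0 < Toda22.tau l m M M' c c' x y k₁ k₂) n₁ n₂ →
        Toda22.SolvesAt (Toda22.soliton l m M M' c c') x y n₁ n₂) ∧
    (∀ (x y : ℝ) (n₁ n₂ : ℤ),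
      Toda22.OnStencil (fun k₁ k₂ => Toda22.tau l m M M' c c' x y k₁ k₂ ≠ 0) n₁ n₂ →
        Toda22.ComplexSolvesAt (Toda22.complexSoliton l m M M' c c') x y n₁ n₂) := by

  have hQ : Toda22.Admissible l m M :=
    ⟨fun k => (hMl k).1, fun k => (hMl k).2, fun k => (hMm k).1, fun k => (hMm k).2⟩
  have hP : Toda22.Admissible l m M' :=
    ⟨fun k => (hMl' k).1, fun k => (hMl' k).2, fun k => (hMm' k).1, fun k => (hMm' k).2⟩
  have hPQ : ∀ j k, M' j ≠ M k := fun j k => (hMM' k j).symm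
  exact ⟨fun x y n₁ n₂ h =>
      Toda22.solvesAt_soliton hlm hlm' hQ hP hPQ c c' x y n₁ n₂ h,
    fun x y n₁ n₂ h =>
      Toda22.complexSolvesAt_complexSoliton hlm hlm' hQ hP hPQ c c' x y n₁ n₂ h⟩
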